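/- Let $G$ be a set with $n=32$ elements. For groups $G(\circ)$, $G(\ast)$ defined on $G$ let $\mathrm{dist}(\circ,\ast)=|\{(a,b)\in G\times G : a\circ b\neq a\ast b\}|$. For a group $G(\circ)$ put $$\delta(\circ)=\min\{\mathrm{dist}(\circ,\ast): G(\ast)\neq G(\circ)\},\quad \delta_{\cong}(\circ)=\min\{\mathrm{dist}(\circ,\ast): G(\circ)\cong G(\ast)\neq G(\circ)\},\quad \delta_{\not\cong}(\circ)=\min\{\mathrm{dist}(\circ,\ast): G(\circ)\not\cong G(\ast)\},$$ where $G(\ast)$ runs over the groups defined on $G$ and the minimum of the empty set is $\infty$. For a bijection $g:G\to G$ let $\circ_g$ be the group operation $a\circ_g b=g(g^{-1}(a)\circ g^{-1}(b))$. Let $\delta_0(\circ)$ be $6n-18$ if $n$ is odd, $6n-20$ if $G(\circ)\cong D(O)$ for some nontrivial commutative group $O$ of odd order, and $6n-24$ otherwise; here $D(O)$ is the generalized dihedral group on $O\times \mathbb{Z}/2$ with $(a,0)(b,h)=(ab,h)$ and $(a,1)(b,h)=(ab^{-1},1+h)$. Then for every group $G(\circ)$ defined on $G$, $$\delta_{\not\cong}(\circ)>\delta_{\cong}(\circ)=\delta_0(\circ)=168,$$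 and there is a transposition $g:G\to G$ such that $\delta(\circ)=\mathrm{dist}(\circ,\circ_g)$. -/

import Mathlib

namespace GroupDist

universe u

variable {G : Type u}

/-- The set of cells in which the multiplication tables of two groups `A = G(∘)`, `B = G(∗)`
on the same underlying set `G` disagree. -/
def diff (A B : Group G) : Set (G × G) :=
  {p | A.mul p.1 p.2 ≠ B.mul p.1 p.2}

/-- The Hamming distance of two groups defined on the same set. -/
noncomputable def dist (A B : Group G) : ℕ∞ :=
  (diff A B).encard

/-- Isomorphism of two groups defined on the same set. -/
def Iso (A B : Group G) : Prop :=
  ∃ f : G ≃ G, ∀ x y : G, f (A.mul x y) = B.mul (f x) (f y)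

/-- The isomorph `∘_f` of `A = G(∘)` under a bijection `f`, with product
`x ∘_f y = f (f⁻¹ x ∘ f⁻¹ y)`, so that `f : G(∘) → G(∘_f)` is an isomorphism. -/
abbrev isomorph (A : Group G) (f : G ≃ G) : Group G :=
  @Equiv.group G G f.symm A

/-- `δ(∘)`: the least distance from `A` to a different group on `G`. Here and below, the minimum
of an empty set is `∞`. (Two `Group` structures are equal iff their multiplications are.) -/
noncomputable def delta (A : Group G) : ℕ∞ :=
  sInf {d | ∃ B : Group G, B ≠ A ∧ d = dist A B}

/-- `δ_≅(∘)`: the least distance from `A` to a different group on `G` isomorphic to `A`. -/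
noncomputable def deltaIso (A : Group G) : ℕ∞ :=
  sInf {d | ∃ B : Group G, Iso A B ∧ B ≠ A ∧ d = dist A B}

/-- `δ_≇(∘)`: the least distance from `A` to a group on `G` not isomorphic to `A`. -/
noncomputable def deltaNonIso (A : Group G) : ℕ∞ :=
  sInf {d | ∃ B : Group G, ¬ Iso A B ∧ d = dist A B}

/-- The underlying set of the generalized dihedral group `D(O)`. -/
def GenDihedral (O : Type u) : Type u := O × ZMod 2

/-- The product of `D(O)`: `(a,0)(b,h) = (ab,h)` and `(a,1)(b,h) = (ab⁻¹,1+h)`. -/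
def genMul {O : Type u} [CommGroup O] (p q : O × ZMod 2) : O × ZMod 2 :=
  (p.1 * (if p.2 = 0 then q.1 else q.1⁻¹), p.2 + q.2)

/-- The generalized dihedral group `D(O)`. -/
instance genDihedralGroup (O : Type u) [CommGroup O] : Group (GenDihedral O) where
  mul p q := genMul p q
  one := ((1 : O), (0 : ZMod 2))
  inv p := (if p.2 = 0 then p.1⁻¹ else p.1, -p.2)
  mul_assoc := by
    have h2 : ∀ i : ZMod 2, i = 0 ∨ i = 1 := by decide
    have h11 : (1 : ZMod 2) + 1 = 0 := rfl
    rintro ⟨a, i⟩ ⟨b, j⟩ ⟨c, k⟩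
    change genMul (genMul (a, i) (b, j)) (c, k) = genMul (a, i) (genMul (b, j) (c, k))
    rcases h2 i with rfl | rfl <;> rcases h2 j with rfl | rfl <;>
      simp [genMul, mul_assoc, ← add_assoc, h11, mul_comm, mul_left_comm]
  one_mul := by
    rintro ⟨a, i⟩
    change genMul (1, 0) (a, i) = (a, i)
    simp [genMul]
  mul_one := by
    rintro ⟨a, i⟩
    change genMul (a, i) (1, 0) = (a, i)
    simp [genMul]
  inv_mul_cancel := by
    have h2 : ∀ i : ZMod 2, i = 0 ∨ i = 1 := by decide
    have h11 : (1 : ZMod 2) + 1 = 0 := rfl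
    rintro ⟨a, i⟩
    change genMul (if i = 0 then a⁻¹ else a, -i) (a, i) = (1, 0)
    rcases h2 i with rfl | rfl <;> simp [genMul, h11]

open Classical in
/-- `δ₀(∘)`, with `n = |G|`: `6n - 18` if `n` is odd, `6n - 20` if `G(∘) ≅ D(O)` for some
nontrivial commutative group `O` of odd order, and `6n - 24` otherwise. -/
noncomputable def delta0 (A : Group G) : ℤ :=
  if Odd (Nat.card G) then 6 * (Nat.card G : ℤ) - 18
  else if ∃ (O : Type u) (_ : CommGroup O), Nontrivial O ∧ Odd (Nat.card O) ∧
      ∃ f : G ≃ GenDihedral O, ∀ x y : G, f (A.mul x y) = f x * f y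
    then 6 * (Nat.card G : ℤ) - 20
  else 6 * (Nat.card G : ℤ) - 24

end GroupDist

/-! The identity map from `G(∘)` to `G(∗)` is a bijection `e` whose defects, the pairs where it is
not multiplicative, are the cells where the tables differ. Suppose there are at most 168. As 6·168 <
32², majority voting on `e (x * y) * (e y)⁻¹` over `y` yields a homomorphism `g`
(`exists_monoidHom_of_card_defects`). Where `g` and `e` differ, over two thirds of the row are
defects, so they differ in `s ≤ 7` places and `g` is an isomorphism. Counting then gives at least
`96s - 6s²` defects (`card_defects_ge`). Since `s = 1` is impossible, either `s = 0` and the tables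
agree, or `s = 2` and there are exactly 168 defects. The bound is attained by swapping `u` and `u *
c` for a central involution `c` (`card_defects_swap`). -/

namespace GroupDist

open Finset

/-- Three sets, each holding more than two thirds of all elements, have a common element. -/
lemma exists_mem_three {G : Type*} [Fintype G] {s t r : Finset G} (hs : 2 * Fintype.card G < 3 * s.card)
    (ht : 2 * Fintype.card G < 3 * t.card) (hr : 2 * Fintype.card G < 3 * r.card) :
    ∃ x, x ∈ s ∧ x ∈ t ∧ x ∈ r := by
  classical
  by_contra! hcon
  have hcov : (univ : Finset G) ⊆ (sᶜ ∪ tᶜ) ∪ rᶜ := by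
    intro x _
    simp only [mem_union, mem_compl]
    by_contra! h
    exact hcon x h.1.1 h.1.2 h.2
  have h0 := card_le_card hcov
  have h1 := card_union_le (sᶜ ∪ tᶜ) rᶜ
  have h2 := card_union_le sᶜ tᶜ
  have h3 := card_add_card_compl s
  have h4 := card_add_card_compl t
  have h5 := card_add_card_compl r
  rw [card_univ] at h0
  omega

/-- The elements at which two maps differ. -/
def moved {G H : Type*} [Fintype G] [DecidableEq H] (g e : G → H) : Finset G :=
  univ.filter fun x => g x ≠ e x

lemma card_moved_ne_one {G H : Type*} [Fintype G] [DecidableEq H] (e g : G → H) (he : Function.Surjective e) (hei : Function.Injective g)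
    (hc : (moved g e).card = 1) : False := by
  obtain ⟨x, hx⟩ := card_eq_one.1 hc
  have hxm : g x ≠ e x := by
    have : x ∈ moved g e := by simp [hx]
    simpa [moved] using this
  obtain ⟨y, hy⟩ := he (g x)
  have hyx : y ≠ x := fun h => hxm (by rw [← hy, h])
  have : y ∈ moved g e := by
    simp only [moved, mem_filter, mem_univ, true_and]
    exact fun h => hyx (hei (by rw [h, hy]))
  rw [hx, mem_singleton] at this
  exact hyx this

/-! ### Almost multiplicative maps and nearby homomorphisms -/

section Testing

variable {G H : Type*} [Group G] [Group H] [Fintype G] [DecidableEq H]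

/-- The pairs at which a map between groups fails to be multiplicative. -/
def defects (e : G → H) : Finset (G × G) :=
  univ.filter fun p => e (p.1 * p.2) ≠ e p.1 * e p.2

/-- The elements `y` at which a map between groups fails to be multiplicative on `(x, y)`. -/
def rowDefects (e : G → H) (x : G) : Finset G :=
  univ.filter fun y => e (x * y) ≠ e x * e y

lemma sum_card_rowDefects (e : G → H) :
    ∑ x, (rowDefects e x).card = (defects e).card := by
  simp only [rowDefects, defects, card_filter, ← univ_product_univ, sum_product]

/-- The votes `y` for the value `v` at `x`. -/
def votes (e : G → H) (x : G) (v : H) : Finset G :=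
  univ.filter fun y => e (x * y) = v * e y

/-- If neither `(y, y⁻¹ * z)` nor `(x * y, y⁻¹ * z)` is a defect, dividing the two product formulas
shows that `y` and `z` cast the same vote at `x`. -/
lemma card_collisions (e : G → H) (x : G) :
    (Fintype.card G) ^ 2 ≤ 2 * (defects e).card +
      (univ.filter fun p : G × G => e (x * p.1) * (e p.1)⁻¹ = e (x * p.2) * (e p.2)⁻¹).card := by
  classical
  set C := univ.filter fun p : G × G => e (x * p.1) * (e p.1)⁻¹ = e (x * p.2) * (e p.2)⁻¹
  let α : G × G → G × G := fun p => (p.1, p.1 * p.2)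
  let β : G × G → G × G := fun p => (x⁻¹ * p.1, x⁻¹ * p.1 * p.2)
  have hcov : (univ : Finset (G × G)) ⊆ ((defects e).image α ∪ (defects e).image β) ∪ C := by
    rintro ⟨y, z⟩ -
    by_cases h1 : (y, y⁻¹ * z) ∈ defects e
    · exact mem_union_left _ (mem_union_left _ (mem_image.2 ⟨_, h1, by simp [α]⟩))
    by_cases h2 : (x * y, y⁻¹ * z) ∈ defects e
    · exact mem_union_left _ (mem_union_right _ (mem_image.2 ⟨_, h2, by simp [β]⟩))
    refine mem_union_right _ ?_
    simp only [defects, mem_filter, mem_univ, true_and, not_not, mul_inv_cancel_left] at h1 h2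
    rw [mul_assoc, mul_inv_cancel_left] at h2
    simp [C, h1, h2]
  have := card_le_card hcov
  rw [card_univ, Fintype.card_prod, ← sq] at this
  have h1 := card_union_le ((defects e).image α ∪ (defects e).image β) C
  have h2 := card_union_le ((defects e).image α) ((defects e).image β)
  have h3 : ((defects e).image α).card ≤ _ := card_image_le
  have h4 : ((defects e).image β).card ≤ _ := card_image_le
  omega

/-- More than two thirds of all pairs agree, so by averaging some `z` agrees with more than two
thirds of the elements. -/
lemma exists_votes (e : G → H) (he : 6 * (defects e).card < (Fintype.card G) ^ 2) (x : G) :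
    ∃ v, 2 * Fintype.card G < 3 * (votes e x v).card := by
  classical
  by_contra! hcon
  have hC := card_collisions e x
  set C := univ.filter fun p : G × G => e (x * p.1) * (e p.1)⁻¹ = e (x * p.2) * (e p.2)⁻¹ with hCdef
  have hsum : C.card = ∑ z, (votes e x (e (x * z) * (e z)⁻¹)).card := by
    rw [hCdef]
    simp only [votes, card_filter, ← univ_product_univ]
    rw [sum_product_right]
    simp only [mul_inv_eq_iff_eq_mul]
  have hle : 3 * C.card ≤ Fintype.card G * (2 * Fintype.card G) := by
    rw [hsum, mul_sum]
    calc _ ≤ ∑ _z : G, 2 * Fintype.card G := sum_le_sum fun z _ => hcon _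
      _ = _ := by simp
  nlinarith

/-- A map between groups with few defects is close to a homomorphism. -/
theorem exists_monoidHom_of_card_defects (e : G → H)
    (he : 6 * (defects e).card < (Fintype.card G) ^ 2) :
    ∃ g : G →* H, ∀ x, g x ≠ e x → 2 * Fintype.card G < 3 * (rowDefects e x).card := by
  classical
  choose g hg using exists_votes e he
  refine ⟨MonoidHom.mk' g ?_, ?_⟩
  · intro x y
    -- A common `z` is sought such that `y * z` votes for `g x`, `z` for `g y`, and `z` for `g (x *
    -- y)`; then `e (x * y * z)` has two expressions.
    have hshift : 2 * Fintype.card G <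
        3 * ((votes e x (g x)).image fun z => y⁻¹ * z).card := by
      rw [card_image_of_injective _ (mul_right_injective _)]
      exact hg x
    obtain ⟨z, h1, h2, h3⟩ := exists_mem_three hshift (hg y) (hg (x * y))
    obtain ⟨w, hw, rfl⟩ := mem_image.1 h1
    simp only [votes, mem_filter, mem_univ, true_and] at hw h2 h3
    rw [mul_assoc, mul_inv_cancel_left, hw] at h3
    rw [mul_inv_cancel_left] at h2
    rw [h2, ← mul_assoc] at h3
    exact (mul_right_cancel h3).symm
  · intro x hx
    have hsub : votes e x (g x) ⊆ rowDefects e x := by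
      intro y hy
      simp only [votes, rowDefects, mem_filter, mem_univ, true_and] at hy ⊢
      rw [hy]
      exact fun h => hx (mul_right_cancel h)
    have := card_le_card hsub
    have := hg x
    omega

lemma card_moved_le (e : G → H) (g : G → H)
    (hg : ∀ x, g x ≠ e x → 2 * Fintype.card G < 3 * (rowDefects e x).card) :
    (moved g e).card * (2 * Fintype.card G + 1) ≤ 3 * (defects e).card := by
  rw [← sum_card_rowDefects, mul_sum]
  calc _ = ∑ _x ∈ moved g e, (2 * Fintype.card G + 1) := by simp
    _ ≤ ∑ x ∈ moved g e, 3 * (rowDefects e x).card :=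
        sum_le_sum fun x hx => hg x (mem_filter.1 hx).2
    _ ≤ _ := sum_le_sum_of_subset (subset_univ _)

/-- For `x ≠ 1` in the kernel, `g` and `e` cannot agree at both `y` and `x * y`, so the moved set
and a translate of it cover `G`. -/
lemma injective_of_card_moved (e : G → H) (he : Function.Injective e) (g : G →* H)
    (h : 2 * (moved g e).card < Fintype.card G) : Function.Injective g := by
  classical
  rw [injective_iff_map_eq_one]
  intro x hx
  by_contra hne
  have hcov : (univ : Finset G) ⊆ moved g e ∪ (moved g e).image fun z => x⁻¹ * z := by
    intro y _
    by_contra hy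
    simp only [mem_union, not_or] at hy
    have h1 : g y = e y := by simpa [moved] using hy.1
    have h2 : g (x * y) = e (x * y) := by
      by_contra h2
      exact hy.2 (mem_image.2 ⟨x * y, by simpa [moved] using h2, by simp⟩)
    rw [map_mul, hx, one_mul, h1] at h2
    exact hne (mul_eq_right.1 (he h2).symm)
  have h0 := card_le_card hcov
  have h1 := card_union_le (moved g e) ((moved g e).image fun z => x⁻¹ * z)
  have h2 : ((moved g e).image fun z => x⁻¹ * z).card ≤ _ := card_image_le
  rw [card_univ] at h0
  omega

/-- An isomorphism differing from the bijection `e` in `s` places forces a defect of `e` at every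
pair `(x, y)` such that exactly one of `x`, `y`, `x * y` is one of these places. -/
lemma card_defects_ge (e : G → H) (g : G →* H) :
    3 * (Fintype.card G : ℤ) * (moved g e).card - 6 * ((moved g e).card : ℤ) ^ 2 ≤
      (defects e).card := by
  classical
  obtain ⟨i, hi⟩ : ∃ i : G → ℤ, i = fun x => if g x ≠ e x then 1 else 0 := ⟨_, rfl⟩
  have hi0 : ∀ x, g x = e x → i x = 0 := fun x hx => by simp [hi, hx]
  have hi1 : ∀ x, g x ≠ e x → i x = 1 := fun x hx => by simp [hi, hx]
  replace hi : ∑ x, i x = (moved g e).card := by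
    rw [hi, moved, card_filter]; push_cast; rfl
  have h1 : ∑ x : G, ∑ _y : G, i x = Fintype.card G * (moved g e).card := by
    rw [← hi, mul_sum]; simp
  have h2 : ∑ _x : G, ∑ y : G, i y = Fintype.card G * (moved g e).card := by
    rw [hi]; simp
  have htr : ∀ x, ∑ y, i (x * y) = (moved g e).card := fun x => by
    rw [← hi]; exact Equiv.sum_comp (Equiv.mulLeft x) i
  have htr' : ∀ y, ∑ x, i (x * y) = (moved g e).card := fun y => by
    rw [← hi]; exact Equiv.sum_comp (Equiv.mulRight y) i
  have h3 : ∑ x : G, ∑ y : G, i (x * y) = Fintype.card G * (moved g e).card := by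
    simp [htr]
  have h4 : ∑ x : G, ∑ y : G, i x * i y = ((moved g e).card : ℤ) ^ 2 := by
    simp_rw [← mul_sum, ← sum_mul, hi, sq]
  have h5 : ∑ x : G, ∑ y : G, i x * i (x * y) = ((moved g e).card : ℤ) ^ 2 := by
    simp_rw [← mul_sum, htr, ← sum_mul, hi, sq]
  have h6 : ∑ x : G, ∑ y : G, i y * i (x * y) = ((moved g e).card : ℤ) ^ 2 := by
    rw [sum_comm]
    simp_rw [← mul_sum, htr', ← sum_mul, hi, sq]
  have hD : ((defects e).card : ℤ) =
      ∑ x : G, ∑ y : G, if e (x * y) ≠ e x * e y then (1 : ℤ) else 0 := by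
    rw [defects, card_filter, ← univ_product_univ, sum_product]
    push_cast
    rfl
  -- The summand is 1 if exactly one of the three elements is moved, 0 if none or two are, and -3 if
  -- all are.
  have hle : ∑ x : G, ∑ y : G, (i x + i y + i (x * y)
      - 2 * (i x * i y + i x * i (x * y) + i y * i (x * y))) ≤ (defects e).card := by
    rw [hD]
    refine sum_le_sum fun x _ => sum_le_sum fun y _ => ?_
    have hm := map_mul g x y
    have hd : (if e (x * y) ≠ e x * e y then (1 : ℤ) else 0) ≥ 0 := by split_ifs <;> simp
    by_cases hx : g x = e x <;> by_cases hy : g y = e y <;>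
      by_cases hxy : g (x * y) = e (x * y)
    · rw [hi0 _ hx, hi0 _ hy, hi0 _ hxy]; linarith
    · have : e (x * y) ≠ e x * e y := fun h => hxy (by rw [hm, hx, hy, h])
      simp [hi0 _ hx, hi0 _ hy, hi1 _ hxy, this]
    · have : e (x * y) ≠ e x * e y := fun h => hy <| mul_left_cancel (a := e x) <| by
        rw [← h, ← hxy, hm, hx]
      simp [hi0 _ hx, hi1 _ hy, hi0 _ hxy, this]
    · rw [hi0 _ hx, hi1 _ hy, hi1 _ hxy]; linarith
    · have : e (x * y) ≠ e x * e y := fun h => hx <| mul_right_cancel (b := e y) <| by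
        rw [← h, ← hxy, hm, hy]
      simp [hi1 _ hx, hi0 _ hy, hi0 _ hxy, this]
    · rw [hi1 _ hx, hi0 _ hy, hi1 _ hxy]; linarith
    · rw [hi1 _ hx, hi1 _ hy, hi0 _ hxy]; linarith
    · rw [hi1 _ hx, hi1 _ hy, hi1 _ hxy]; linarith
  have hexp : ∑ x : G, ∑ y : G, (i x + i y + i (x * y)
      - 2 * (i x * i y + i x * i (x * y) + i y * i (x * y))) =
      ∑ x : G, ∑ _y : G, i x + ∑ _x : G, ∑ y : G, i y + ∑ x : G, ∑ y : G, i (x * y)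
      - 2 * (∑ x : G, ∑ y : G, i x * i y + ∑ x : G, ∑ y : G, i x * i (x * y)
        + ∑ x : G, ∑ y : G, i y * i (x * y)) := by
    simp only [sum_sub_distrib, sum_add_distrib, mul_sum, mul_add]
  rw [hexp, h1, h2, h3, h4, h5, h6] at hle
  linarith

/-- A bijection between groups of order 32 with at most 168 defects is close to an isomorphism, and
if it has a defect, it has 168 of them. -/
theorem exists_mulEquiv_of_card_defects (e : G ≃ H) (hG : Fintype.card G = 32)
    (hD : (defects e).card ≤ 168) :
    (∃ f : G ≃ H, ∀ x y, f (x * y) = f x * f y) ∧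
      ((∃ x y, e (x * y) ≠ e x * e y) → (defects e).card = 168) := by
  obtain ⟨g, hg⟩ := exists_monoidHom_of_card_defects (e : G → H) (by rw [hG]; omega)
  have hs := card_moved_le _ _ hg
  rw [hG] at hs
  have hinj := injective_of_card_moved e e.injective g (by rw [hG]; omega)
  have hbij : Function.Bijective g := by
    refine ⟨hinj, fun y => ?_⟩
    -- Composing with `e.symm` gives an injective self-map of the finite set `G`.
    obtain ⟨x, hx⟩ := (Finite.injective_iff_surjective (f := fun x => e.symm (g x))).1
      (e.symm.injective.comp hinj) (e.symm y)
    exact ⟨x, e.symm.injective hx⟩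
  refine ⟨⟨Equiv.ofBijective g hbij, map_mul g⟩, fun ⟨x, y, hxy⟩ => ?_⟩
  have hlow := card_defects_ge e g
  rw [hG] at hlow
  have h1 := card_moved_ne_one e g e.surjective hinj
  have h0 : (moved g e).card ≠ 0 := by
    intro h0
    have : ∀ z, g z = e z := fun z => by
      by_contra hz
      have : z ∈ moved g e := by simp [moved, hz]
      rw [card_eq_zero.1 h0] at this
      simp at this
    exact hxy (by rw [← this, ← this, ← this, map_mul])
  -- This is `65s ≤ 3·168`. On `2 ≤ s ≤ 7`, `96s - 6s²` is 168 at `s = 2` and at least 234 beyond.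
  have h7 : (moved g e).card ≤ 7 := by omega
  generalize (moved g e).card = s at *
  interval_cases s <;> simp_all <;> omega

end Testing

/-! ### A transposition attaining the bound -/

/-- A group of order 32 has a central involution. -/
lemma exists_central_involution {G : Type*} [Group G] [Fintype G] (hG : Fintype.card G = 32) :
    ∃ c : G, (∀ x, c * x = x * c) ∧ c * c = 1 ∧ c ≠ 1 := by
  have : Fact (Nat.Prime 2) := ⟨Nat.prime_two⟩
  have hp : IsPGroup 2 G := IsPGroup.of_card (n := 5) (by rw [Nat.card_eq_fintype_card, hG]; rfl)
  have : Nontrivial G := Fintype.one_lt_card_iff_nontrivial.1 (by omega)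
  have := hp.center_nontrivial
  have hdvd : 2 ∣ Nat.card (Subgroup.center G) := by
    obtain ⟨n, hn, h⟩ := (hp.to_subgroup (Subgroup.center G)).nontrivial_iff_card.1 this
    rw [h]
    exact dvd_pow_self 2 hn.ne'
  obtain ⟨c, hc⟩ := exists_prime_orderOf_dvd_card' 2 hdvd
  refine ⟨c, fun x => (Subgroup.mem_center_iff.1 c.2 x).symm, ?_, ?_⟩
  · have := pow_orderOf_eq_one c
    rw [hc, sq] at this
    exact_mod_cast congrArg Subtype.val this
  · intro h
    have h1 : c = 1 := Subtype.ext h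
    rw [h1, orderOf_one] at hc
    omega

section Swap

variable {G : Type*} [Group G] [Fintype G] [DecidableEq G]

/-- The swap multiplies `S = {u, u * c}` by `c` and fixes the rest. As `c` is a central involution,
a defect has exactly one of `x`, `y`, `x * y` in `S`, and a factor outside `S ∪ {1, c}`: at most
3·2·28 pairs. -/
lemma card_defects_swap_le (hG : Fintype.card G = 32) {c u : G} (hc : ∀ x, c * x = x * c)
    (hcc : c * c = 1) (hc1 : c ≠ 1) (hu1 : u ≠ 1) (huc : u ≠ c) :
    (defects (Equiv.swap u (u * c))).card ≤ 168 := by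
  have hCcard : ({1, c, u, u * c} : Finset G).card = 4 := by
    have h1 : u * c ≠ 1 := fun h => huc (mul_right_cancel (h.trans hcc.symm))
    have h2 : u * c ≠ c := fun h => hu1 (mul_eq_right.1 h)
    have h3 : u * c ≠ u := fun h => hc1 (mul_eq_left.1 h)
    rw [card_insert_of_notMem, card_insert_of_notMem, card_pair h3.symm] <;>
      simp [hc1.symm, hu1.symm, huc.symm, h1.symm, h2.symm]
  obtain ⟨S, hS⟩ : ∃ S : Finset G, S = {u, u * c} := ⟨_, rfl⟩
  have memS : ∀ z, z ∈ S ↔ z = u ∨ z = u * c := by simp [hS]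
  obtain ⟨U, hU⟩ : ∃ U : Finset G, U = ({1, c, u, u * c} : Finset G)ᶜ := ⟨_, rfl⟩
  have memU : ∀ z, z ∉ S → ¬(z = 1 ∨ z = c) → z ∈ U := by
    intro z h1 h2
    rw [memS] at h1
    simp only [hU, mem_compl, mem_insert, mem_singleton]
    tauto
  have hScard : S.card ≤ 2 := hS ▸ card_le_two
  have hUcard : U.card = 28 := by rw [hU, card_compl, hG, hCcard]
  have hSc : ∀ z, z ∈ S → z * c ∈ S := by
    intro z hz
    rw [memS] at hz ⊢
    rcases hz with rfl | rfl
    · exact Or.inr rfl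
    · exact Or.inl (by rw [mul_assoc, hcc, mul_one])
  have hSc' : ∀ z, z * c ∈ S → z ∈ S := by
    intro z hz
    simpa [mul_assoc, hcc] using hSc _ hz
  have hcS : ∀ z, z ∈ S → ¬(z = 1 ∨ z = c) := by
    intro z hz h
    have h1S : (1 : G) ∈ S := by
      rcases h with rfl | rfl
      · exact hz
      · exact hSc' _ (by rwa [one_mul])
    rcases (memS 1).1 h1S with h | h
    · exact hu1 h.symm
    · exact huc (mul_right_cancel (h.symm.trans hcc.symm))
  have hdiv : ∀ x y, x ∈ S → x * y ∈ S → y = 1 ∨ y = c := by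
    intro x y hx hxy
    rw [memS] at hx hxy
    rcases hx with rfl | rfl <;> rcases hxy with h | h
    · exact Or.inl (mul_eq_left.1 h)
    · exact Or.inr (mul_left_cancel h)
    · rw [mul_assoc, mul_eq_left] at h
      exact Or.inr (mul_left_cancel (h.trans hcc.symm))
    · exact Or.inl (mul_eq_left.1 h)
  have hgS : ∀ z, z ∈ S → Equiv.swap u (u * c) z = z * c := by
    intro z hz
    rcases (memS z).1 hz with rfl | rfl
    · exact Equiv.swap_apply_left _ _
    · rw [Equiv.swap_apply_right, mul_assoc, hcc, mul_one]
  have hgN : ∀ z, z ∉ S → Equiv.swap u (u * c) z = z := by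
    intro z hz
    rw [memS, not_or] at hz
    exact Equiv.swap_apply_of_ne_of_ne hz.1 hz.2
  generalize Equiv.swap u (u * c) = g at hgS hgN ⊢
  have hcov : defects g ⊆
      (S ×ˢ U ∪ U ×ˢ S) ∪ (U ×ˢ S).image fun p => (p.1, p.1⁻¹ * p.2) := by
    rintro ⟨x, y⟩ hxy
    simp only [defects, mem_filter, mem_univ, true_and] at hxy
    by_contra hcon
    simp only [mem_union, mem_product, not_or] at hcon
    obtain ⟨⟨n1, n2⟩, n3⟩ := hcon
    refine hxy ?_
    by_cases hx : x ∈ S <;> by_cases hy : y ∈ S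
    · rw [hgS x hx, hgS y hy, hgN (x * y) fun h => hcS y hy (hdiv x y hx h), mul_assoc x c,
        hc, mul_assoc y, hcc, mul_one]
    · have hyc : y = 1 ∨ y = c := by
        by_contra h
        exact n1 ⟨hx, memU y hy h⟩
      have hm : x * y ∈ S := by
        rcases hyc with rfl | rfl
        · rwa [mul_one]
        · exact hSc _ hx
      rw [hgS x hx, hgN y hy, hgS _ hm, mul_assoc, ← hc, mul_assoc]
    · have hxc : x = 1 ∨ x = c := by
        by_contra h
        exact n2 ⟨memU x hx h, hy⟩
      have hm : x * y ∈ S := by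
        rcases hxc with rfl | rfl
        · rwa [one_mul]
        · rw [hc]; exact hSc _ hy
      rw [hgN x hx, hgS y hy, hgS _ hm, mul_assoc]
    · have hm : x * y ∉ S := by
        intro hm
        by_cases hxc : x = 1 ∨ x = c
        · refine hy ?_
          rcases hxc with rfl | rfl
          · rwa [one_mul] at hm
          · rw [hc] at hm; exact hSc' _ hm
        · exact n3 (mem_image.2 ⟨(x, x * y), mem_product.2 ⟨memU x hx hxc, hm⟩, by simp⟩)
      rw [hgN x hx, hgN y hy, hgN _ hm]
  have h0 := card_le_card hcov
  have h1 := card_union_le (S ×ˢ U ∪ U ×ˢ S) ((U ×ˢ S).image fun p => (p.1, p.1⁻¹ * p.2))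
  have h2 := card_union_le (S ×ˢ U) (U ×ˢ S)
  have h3 : ((U ×ˢ S).image fun p : G × G => (p.1, p.1⁻¹ * p.2)).card ≤ _ := card_image_le
  rw [card_product, hUcard] at h3
  rw [card_product, card_product, hUcard] at h2
  omega

lemma card_defects_swap (hG : Fintype.card G = 32) {c u : G} (hc : ∀ x, c * x = x * c)
    (hcc : c * c = 1) (hc1 : c ≠ 1) (hu1 : u ≠ 1) (huc : u ≠ c) :
    (defects (Equiv.swap u (u * c))).card = 168 := by
  refine le_antisymm (card_defects_swap_le hG hc hcc hc1 hu1 huc) ?_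
  -- The identity differs from the swap in two places, and 3·32·2 - 6·2² = 168.
  have h := card_defects_ge (Equiv.swap u (u * c)) (MonoidHom.id G)
  have hm : moved (MonoidHom.id G) (Equiv.swap u (u * c)) = (Equiv.swap u (u * c)).support := by
    ext x
    simp [moved, eq_comm]
  rw [hm, Equiv.Perm.card_support_swap (fun h => hc1 (mul_eq_left.1 h.symm)), hG] at h
  norm_num at h
  exact_mod_cast h

end Swap

/-! ### Distances between groups on one set -/

lemma iso_isomorph {G : Type*} (A : Group G) (f : G ≃ G) : Iso A (isomorph A f) := by
  refine ⟨f, fun x y => ?_⟩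
  change f (A.mul x y) = f (A.mul (f.symm (f x)) (f.symm (f y)))
  rw [f.symm_apply_apply, f.symm_apply_apply]

section SameSet

variable {G : Type*} [Fintype G] [DecidableEq G]

lemma dist_eq_card_defects (A B : Group G) :
    dist A B = ((@defects G G A B _ _ (Equiv.refl G)).card : ℕ∞) := by
  rw [dist, ← Set.encard_coe_eq_coe_finsetCard]
  congr 1
  ext p
  simp only [diff, defects, coe_filter, mem_univ, true_and, Set.mem_ofPred_eq]
  rfl

lemma dist_isomorph_swap (A : Group G) (u v : G) :
    dist A (isomorph A (Equiv.swap u v)) =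
      ((@defects G G A A _ _ (Equiv.swap u v)).card : ℕ∞) := by
  rw [dist, ← Set.encard_coe_eq_coe_finsetCard]
  congr 1
  ext p
  simp only [diff, defects, coe_filter, mem_univ, true_and, Set.mem_ofPred_eq]
  refine not_congr ?_
  change A.mul p.1 p.2 = Equiv.swap u v (A.mul ((Equiv.swap u v).symm p.1)
    ((Equiv.swap u v).symm p.2)) ↔ Equiv.swap u v (A.mul p.1 p.2) =
      A.mul (Equiv.swap u v p.1) (Equiv.swap u v p.2)
  rw [Equiv.symm_swap, ← Equiv.apply_eq_iff_eq (Equiv.swap u v), Equiv.swap_apply_self]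

lemma exists_mul_ne {A B : Group G} (h : B ≠ A) : ∃ x y, A.mul x y ≠ B.mul x y := by
  by_contra! hcon
  refine h (Group.ext ?_)
  funext x y
  exact (hcon x y).symm

lemma iso_and_dist_eq {A B : Group G} (hG : Fintype.card G = 32) (h : B ≠ A)
    (hd : dist A B ≤ 168) : Iso A B ∧ dist A B = 168 := by
  rw [dist_eq_card_defects] at hd ⊢
  obtain ⟨hf, h168⟩ := @exists_mulEquiv_of_card_defects G G A B _ _ (Equiv.refl G) hG
    (by exact_mod_cast hd)
  exact ⟨hf, by exact_mod_cast h168 (exists_mul_ne h)⟩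

lemma le_dist {A B : Group G} (hG : Fintype.card G = 32) (h : B ≠ A) : 168 ≤ dist A B := by
  rcases le_total (dist A B) 168 with hd | hd
  · exact (iso_and_dist_eq hG h hd).2.ge
  · exact hd

lemma lt_dist {A B : Group G} (hG : Fintype.card G = 32) (h : ¬ Iso A B) : 168 < dist A B := by
  by_contra! hd
  have hne : B ≠ A := by
    rintro rfl
    exact h ⟨Equiv.refl G, fun _ _ => rfl⟩
  exact h (iso_and_dist_eq hG hne hd).1

lemma exists_swap (A : Group G) (hG : Fintype.card G = 32) :
    ∃ g : Equiv.Perm G, g.IsSwap ∧ isomorph A g ≠ A ∧ dist A (isomorph A g) = 168 := by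
  obtain ⟨c, hc, hcc, hc1⟩ := exists_central_involution hG
  obtain ⟨u, hu⟩ : ∃ u, u ∉ ({1, c} : Finset G) := by
    by_contra! h
    have h1 := card_le_card (fun x _ => h x : (univ : Finset G) ⊆ {1, c})
    have h2 : ({1, c} : Finset G).card ≤ 2 := card_le_two
    rw [card_univ] at h1
    omega
  simp only [mem_insert, mem_singleton, not_or] at hu
  have huc : u ≠ u * c := fun h => hc1 (mul_eq_left.1 h.symm)
  have hd : dist A (isomorph A (Equiv.swap u (u * c))) = 168 := by
    rw [dist_isomorph_swap]
    exact_mod_cast card_defects_swap hG hc hcc hc1 hu.1 hu.2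
  refine ⟨_, ⟨u, u * c, huc, rfl⟩, fun h => ?_, hd⟩
  have h0 : dist A A = 0 := by simp [dist, diff]
  rw [h, h0] at hd
  exact absurd hd (by decide)

end SameSet

lemma delta0_eq {G : Type*} (A : Group G) (hG : Nat.card G = 32) : delta0 A = 168 := by
  have h1 : ¬ Odd (Nat.card G) := by rw [hG]; decide
  rw [delta0, if_neg h1, if_neg, hG]
  · norm_num
  · rintro ⟨O, _, _, hO, f, -⟩
    -- A generalized dihedral group over an odd order group has order 2 mod 4, unlike 32.
    have h2 : Nat.card G = Nat.card O * 2 := by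
      rw [Nat.card_congr f, GenDihedral, Nat.card_prod, Nat.card_zmod]
    obtain ⟨k, hk⟩ := hO
    omega

end GroupDist

theorem corollary5p2 {G : Type*} [DecidableEq G] (A : Group G) (hG : Nat.card G = 32) :
    GroupDist.deltaNonIso A > GroupDist.deltaIso A ∧
    GroupDist.deltaIso A = 168 ∧
    GroupDist.delta0 A = 168 ∧
    ∃ g : Equiv.Perm G, g.IsSwap ∧
      GroupDist.delta A = GroupDist.dist A (GroupDist.isomorph A g) := by
  have : Finite G := Nat.finite_of_card_ne_zero (by omega)
  have := Fintype.ofFinite G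
  have hG' : Fintype.card G = 32 := by rw [← Nat.card_eq_fintype_card, hG]
  obtain ⟨g, hg, hne, hd⟩ := GroupDist.exists_swap A hG'
  have hiso : GroupDist.deltaIso A = 168 := by
    refine le_antisymm (sInf_le ⟨_, GroupDist.iso_isomorph A g, hne, hd.symm⟩) (le_sInf ?_)
    rintro _ ⟨B, -, hB, rfl⟩
    exact GroupDist.le_dist hG' hB
  refine ⟨?_, hiso, GroupDist.delta0_eq A hG, g, hg, ?_⟩
  -- A strict bound need not survive an infimum; the bound `168 + 1 ≤ d` does, also over the empty
  -- set.
  · rw [hiso, gt_iff_lt, ← ENat.add_one_le_iff (by decide)]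
    refine le_sInf ?_
    rintro _ ⟨B, hB, rfl⟩
    exact (ENat.add_one_le_iff (by decide)).2 (GroupDist.lt_dist hG' hB)
  · rw [hd]
    refine le_antisymm (sInf_le ⟨_, hne, hd.symm⟩) (le_sInf ?_)
    rintro _ ⟨B, hB, rfl⟩
    exact GroupDist.le_dist hG' hB
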